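/- All alphabets are finite, logarithms are natural, and a conditional law $P_{B|A}$ is a stochastic matrix. Given alphabets $\mathcal S,\mathcal X,\mathcal Y,\widehat{\mathcal S}$, a source law $P_S$, a channel $P_{Y|X}$ and a loss $\kappa:\mathcal S\times\mathcal X\times\mathcal Y\times\widehat{\mathcal S}\to\mathbb R$, let $$\mathrm{OPT}(\mathrm{SC})=\inf\ \sum_{s,x,y,\hat s}\kappa(s,x,y,\hat s)\,P_S(s)Q_{X|S}(x|s)P_{Y|X}(y|x)Q_{\widehat S|Y}(\hat s|y),$$ the infimum being over all codes, i.e. pairs of a (possibly randomized) encoder $Q_{X|S}$ and decoder $Q_{\widehat S|Y}$. Let $\mathrm{OPT}(\mathrm{DP})$ be the supremum of $$\sum_s\gamma^a(s)+\sum_y\gamma^b(y)-\sum_{s,x,y,\hat s}\mu(s,x,y,\hat s)$$ over all real functions $\gamma^a(s),\gamma^b(y),\lambda^a(s,\hat s,y),\lambda^b(x,s,y)$ and $\mu(s,x,y,\hat s)\ge 0$ such that, for all $s,x,y,\hat s$, $$\gamma^a(s)-\sum_{y}\lambda^b(x,s,y)-\sum_{\hat s,y}\mu(s,x,y,\hat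 s)\le 0,\qquad \gamma^b(y)-\sum_{s}\lambda^a(s,\hat s,y)-\sum_{x,s}\mu(s,x,y,\hat s)\le 0,$$ $$\lambda^a(s,\hat s,y)+\lambda^b(x,s,y)+\mu(s,x,y,\hat s)\le\kappa(s,x,y,\hat s)P_S(s)P_{Y|X}(y|x).$$ For a probability distribution $P_{\bar Y}$ on $\mathcal Y$ let $i_{X;\bar Y}(x;y)=\log\frac{P_{Y|X}(y|x)}{P_{\bar Y}(y)}\in[-\infty,\infty]$, with value $-\infty$ if $P_{Y|X}(y|x)=0$ and $+\infty$ if $P_{Y|X}(y|x)>0=P_{\bar Y}(y)$. **Corollary (DP improves on Wolfowitz's converse).** Let $M\ge 1$, $\mathcal S=\widehat{\mathcal S}=\{1,\dots,M\}$, $P_S(s)=1/M$, $\kappa(s,x,y,\hat s)=\mathbb I\{s\ne\hat s\}$, and let $P_{Y|X}$ be a channel with $\mathcal X\neq\emptyset$. Then, for every code, deterministic or randomized, $$\mathbb P[S\ne\widehat S]\ \ge\ \mathrm{OPT}(\mathrm{SC})\ \ge\ \mathrm{OPT}(\mathrm{DP})\ \ge\ B(P_{Y|X},M),$$ where $$B(P_{Y|X},M)=\sup_{\gamma\in\mathbb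 R}\sup_{P_{\bar Y}}\Big\{\inf_x\Big[\mathbb P[i_{X;\bar Y}(x;Y)\le\log M-\gamma]+Me^{-\gamma}\sum_{y}P_{\bar Y}(y)\,\mathbb I\{i_{X;\bar Y}(x;y)>\log M-\gamma\}\Big]-e^{-\gamma}\Big\},$$ $\mathbb P$ inside the braces being with respect to $Y\sim P_{Y|X=x}$. This bound is at least as large as Wolfowitz's bound: $$B(P_{Y|X},M)\ \ge\ \sup_{\gamma>0}\sup_{P_{\bar Y}}\Big\{\inf_x\mathbb P[i_{X;\bar Y}(x;Y)\le\log M-\gamma]-e^{-\gamma}\Big\}.$$ Further, let $V$ be a channel from a nonempty finite alphabet $\mathcal A$ to a finite alphabet $\mathcal B$, let $C=\sup_{P_X}I(X;Y)$ be its capacity in nats, and let $R>C$. For each $n$ let $P^{(n)}(y|x)=\prod_{i=1}^nV(y_i|x_i)$ be the stationary memoryless channel from $\mathcal A^n$ to $\mathcal B^n$, and let $M_n$ be integers with $M_n\ge\lfloor e^{nR}\rfloor$ for all large $n$ (in particular $M_n=e^{nR}$ when this is an integer, or $e^{nR}$ rounded up or down). Then, as $n\to\infty$, $B(P^{(n)},M_n)$,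 and hence also $\mathrm{OPT}(\mathrm{DP})$ and $\mathrm{OPT}(\mathrm{SC})$ for $M_n$ messages over $P^{(n)}$, tend to $1$. -/

import Mathlib

open Filter Topology

namespace JSCC

noncomputable section

/-- A channel (stochastic kernel) between finite alphabets: every row is a probability vector. -/
def IsChannel {A B : Type*} [Fintype B] (W : A → B → ℝ) : Prop :=
  ∀ a, W a ∈ stdSimplex ℝ B

section General

variable {S X Y T : Type*} [Fintype S] [Fintype X] [Fintype Y] [Fintype T]

/-- Expected loss `E[κ(S, X, Y, Ŝ)]` of the randomized code with encoder `E = Q_{X|S}` and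
decoder `D = Q_{Ŝ|Y}`, for the source law `P` and the channel `W = P_{Y|X}`. -/
def expectedLoss (κ : S → X → Y → T → ℝ) (P : S → ℝ) (W : X → Y → ℝ)
    (E : S → X → ℝ) (D : Y → T → ℝ) : ℝ :=
  ∑ s, ∑ x, ∑ y, ∑ t, κ s x y t * (P s * E s x * W x y * D y t)

/-- `OPT(SC)`: the least expected loss over all (randomized) codes. -/
def optSC (κ : S → X → Y → T → ℝ) (P : S → ℝ) (W : X → Y → ℝ) : EReal :=
  ⨅ (E : S → X → ℝ) (_ : IsChannel E) (D : Y → T → ℝ) (_ : IsChannel D),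
    ((expectedLoss κ P W E D : ℝ) : EReal)

/-- The variables of the dual program `DP`. -/
structure DualVars (S X Y T : Type*) where
  gammaA : S → ℝ
  gammaB : Y → ℝ
  lambdaA : S → T → Y → ℝ
  lambdaB : X → S → Y → ℝ
  mu : S → X → Y → T → ℝ

/-- The objective of the dual program `DP`. -/
def DualVars.objective (v : DualVars S X Y T) : ℝ :=
  ∑ s, v.gammaA s + ∑ y, v.gammaB y - ∑ s, ∑ x, ∑ y, ∑ t, v.mu s x y t

/-- The constraints of the dual program `DP`. -/
structure DualVars.Feasible (κ : S → X → Y → T → ℝ) (P : S → ℝ) (W : X → Y → ℝ)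
    (v : DualVars S X Y T) : Prop where
  d1 : ∀ x s, v.gammaA s - ∑ y, v.lambdaB x s y - ∑ t, ∑ y, v.mu s x y t ≤ 0
  d2 : ∀ t y, v.gammaB y - ∑ s, v.lambdaA s t y - ∑ x, ∑ s, v.mu s x y t ≤ 0
  d3 : ∀ s x y t, v.lambdaA s t y + v.lambdaB x s y + v.mu s x y t ≤ κ s x y t * P s * W x y
  mu_nonneg : ∀ s x y t, 0 ≤ v.mu s x y t

/-- `OPT(DP)`: the supremum of the dual objective over the dual feasible points. -/
def optDP (κ : S → X → Y → T → ℝ) (P : S → ℝ) (W : X → Y → ℝ) : EReal :=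
  ⨆ (v : DualVars S X Y T) (_ : v.Feasible κ P W), ((v.objective : ℝ) : EReal)

end General

/-! Channel coding with `M` equiprobable messages. -/

/-- The error loss `𝟙{s ≠ ŝ}`. -/
def errorLoss (M : ℕ) (X Y : Type*) : Fin M → X → Y → Fin M → ℝ :=
  fun s _ _ t => if s ≠ t then 1 else 0

/-- The uniform law on `M` messages. -/
def uniformSource (M : ℕ) : Fin M → ℝ := fun _ => 1 / (M : ℝ)

/-- Error probability `P[S ≠ Ŝ]` of the deterministic code `(f, g)`, `S` uniform. -/
def detError {X Y : Type*} [Fintype Y] {M : ℕ} (W : X → Y → ℝ) (f : Fin M → X) (g : Y → Fin M) :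
    ℝ :=
  ∑ s, (1 / (M : ℝ)) * ∑ y, if g y ≠ s then W (f s) y else 0

section Bounds

variable {X Y : Type*} [Fintype Y]

/-- The information density `log (P_{Y|X}(y|x) / Q(y))`, extended-real valued:
it is `-∞` if `P_{Y|X}(y|x) = 0`, and `+∞` if `P_{Y|X}(y|x) > 0 = Q(y)`. -/
def infoDensity (W : X → Y → ℝ) (Q : Y → ℝ) (x : X) (y : Y) : EReal :=
  ENNReal.log (ENNReal.ofReal (W x y) / ENNReal.ofReal (Q y))

/-- `P[i(x; Y) ≤ c]` with `Y` distributed according to `P_{Y|X=x}`. -/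
def probInfoLe (W : X → Y → ℝ) (Q : Y → ℝ) (x : X) (c : ℝ) : ℝ :=
  ∑ y, W x y * (if infoDensity W Q x y ≤ (c : EReal) then 1 else 0)

/-- `∑_y Q(y) 𝟙{i(x; y) > c}`. -/
def massInfoGt (W : X → Y → ℝ) (Q : Y → ℝ) (x : X) (c : ℝ) : ℝ :=
  ∑ y, Q y * (if (c : EReal) < infoDensity W Q x y then 1 else 0)

/-- The improved lower bound on the error probability. -/
def improvedBound (W : X → Y → ℝ) (M : ℕ) : EReal :=
  ⨆ (γ : ℝ) (Q : Y → ℝ) (_ : Q ∈ stdSimplex ℝ Y),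
    (((⨅ x, (probInfoLe W Q x (Real.log M - γ)
        + M * Real.exp (-γ) * massInfoGt W Q x (Real.log M - γ))) - Real.exp (-γ) : ℝ) : EReal)

/-- Wolfowitz's lower bound on the error probability. -/
def wolfowitzBound (W : X → Y → ℝ) (M : ℕ) : EReal :=
  ⨆ (γ : ℝ) (_ : 0 < γ) (Q : Y → ℝ) (_ : Q ∈ stdSimplex ℝ Y),
    (((⨅ x, probInfoLe W Q x (Real.log M - γ)) - Real.exp (-γ) : ℝ) : EReal)

end Bounds

section Memoryless

variable {A B : Type*} [Fintype A] [Fintype B]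

/-- The mutual information `I(X; Y)` (in nats) of the input law `P` and the channel `V`. -/
def mutualInfo (P : A → ℝ) (V : A → B → ℝ) : ℝ :=
  ∑ a, ∑ b, P a * V a b * Real.log (V a b / ∑ a', P a' * V a' b)

/-- The capacity (in nats) of the channel `V`. -/
def capacity (V : A → B → ℝ) : ℝ :=
  sSup ((fun P : A → ℝ => mutualInfo P V) '' stdSimplex ℝ A)

/-- The `n`-fold stationary memoryless channel with single-letter law `V`. -/
def memoryless (V : A → B → ℝ) (n : ℕ) : (Fin n → A) → (Fin n → B) → ℝ :=
  fun x y => ∏ i, V (x i) (y i)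

end Memoryless

end

end JSCC

/-!
For the dual feasible point, keep only the part of the channel lying below `M e^{-γ} P_Ȳ`:
`λᵇ = min (P_{Y|X}, M e^{-γ} P_Ȳ) / M`, with `λᵃ` cancelling it on the diagonal `s = ŝ`, where the
loss vanishes. The smallest mass of `min (P_{Y|X=x}, M e^{-γ} P_Ȳ)` over the inputs `x` is the
infimum in the improved bound, and weak duality turns it into a converse.

For the strong converse, the output law `Q` of a capacity-achieving input satisfies
`D(V_a ‖ Q) ≤ C` for every letter `a`, since moving the input slightly towards `a` cannot increase
the mutual information. Hence, whatever the channel input, a Chernoff bound shows that the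
information density relative to `Qⁿ` exceeds `n (C + δ)` with exponentially small probability, and
`γ = n δ` makes Wolfowitz's bound tend to `1`. The other quantities lie between it and `1`.
-/

namespace JSCC

noncomputable section

section WeakDuality

variable {S X Y T : Type*} [Fintype S] [Fintype X] [Fintype Y] [Fintype T]

theorem IsChannel.sum_le_sum_sum_mul {E : S → X → ℝ} (hE : IsChannel E) {f : S → ℝ}
    {g : S → X → ℝ} (hfg : ∀ s x, f s ≤ g s x) : ∑ s, f s ≤ ∑ s, ∑ x, E s x * g s x := by
  refine Finset.sum_le_sum fun s _ => ?_
  calc f s = ∑ x, E s x * f s := by rw [← Finset.sum_mul, (hE s).2, one_mul]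
    _ ≤ ∑ x, E s x * g s x :=
      Finset.sum_le_sum fun x _ => mul_le_mul_of_nonneg_left (hfg s x) ((hE s).1 x)

variable {κ : S → X → Y → T → ℝ} {P : S → ℝ} {W : X → Y → ℝ} {v : DualVars S X Y T}
  {E : S → X → ℝ} {D : Y → T → ℝ}

theorem DualVars.Feasible.sum_gammaA_le (hv : v.Feasible κ P W) (hE : IsChannel E)
    (hD : IsChannel D) :
    ∑ s, v.gammaA s ≤
      ∑ s, ∑ x, ∑ y, ∑ t, E s x * (D y t * v.lambdaB x s y + v.mu s x y t) := by
  simp only [← Finset.mul_sum]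
  refine hE.sum_le_sum_sum_mul fun s x => ?_
  simp only [Finset.sum_add_distrib, ← Finset.sum_mul, (hD _).2, one_mul]
  rw [Finset.sum_comm (f := fun y t => v.mu s x y t)]
  linarith [hv.d1 x s]

theorem DualVars.Feasible.sum_gammaB_le (hv : v.Feasible κ P W) (hE : IsChannel E)
    (hD : IsChannel D) :
    ∑ y, v.gammaB y ≤
      ∑ y, ∑ t, ∑ s, ∑ x, D y t * (E s x * v.lambdaA s t y + v.mu s x y t) := by
  simp only [← Finset.mul_sum]
  refine hD.sum_le_sum_sum_mul fun y t => ?_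
  simp only [Finset.sum_add_distrib, ← Finset.sum_mul, (hE _).2, one_mul]
  rw [Finset.sum_comm (f := fun s x => v.mu s x y t)]
  linarith [hv.d2 t y]

theorem DualVars.Feasible.integrand_le_loss (hv : v.Feasible κ P W) (hE : IsChannel E)
    (hD : IsChannel D) (s : S) (x : X) (y : Y) (t : T) :
    E s x * (D y t * v.lambdaB x s y + v.mu s x y t)
        + D y t * (E s x * v.lambdaA s t y + v.mu s x y t) - v.mu s x y t
      ≤ κ s x y t * (P s * E s x * W x y * D y t) := by
  have hE1 : 0 ≤ 1 - E s x := sub_nonneg.2 (mem_Icc_of_mem_stdSimplex (hE s) x).2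
  have hD1 : 0 ≤ 1 - D y t := sub_nonneg.2 (mem_Icc_of_mem_stdSimplex (hD y) t).2
  have hloss := mul_le_mul_of_nonneg_left (hv.d3 s x y t) (mul_nonneg ((hE s).1 x) ((hD y).1 t))
  -- `E + D - 1 ≤ E * D` for `E, D ∈ [0, 1]`: here the sign of `mu` enters
  have hmu := mul_nonneg (hv.mu_nonneg s x y t) (mul_nonneg hE1 hD1)
  linarith

theorem DualVars.Feasible.objective_le_expectedLoss (hv : v.Feasible κ P W) (hE : IsChannel E)
    (hD : IsChannel D) : v.objective ≤ expectedLoss κ P W E D := by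
  have hswap : ∑ y, ∑ t, ∑ s, ∑ x, D y t * (E s x * v.lambdaA s t y + v.mu s x y t)
      = ∑ s, ∑ x, ∑ y, ∑ t, D y t * (E s x * v.lambdaA s t y + v.mu s x y t) := by
    simp only [← Fintype.sum_prod_type' (f := fun (_ : S) (_ : X) => _),
      ← Fintype.sum_prod_type' (f := fun (_ : Y) (_ : T) => _)]
    exact Finset.sum_comm
  calc v.objective
      ≤ ∑ s, ∑ x, ∑ y, ∑ t, E s x * (D y t * v.lambdaB x s y + v.mu s x y t)
        + ∑ s, ∑ x, ∑ y, ∑ t, D y t * (E s x * v.lambdaA s t y + v.mu s x y t)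
        - ∑ s, ∑ x, ∑ y, ∑ t, v.mu s x y t := by
        rw [← hswap]
        exact sub_le_sub_right (add_le_add (hv.sum_gammaA_le hE hD) (hv.sum_gammaB_le hE hD)) _
    _ ≤ expectedLoss κ P W E D := by
        simp only [expectedLoss, ← Finset.sum_add_distrib, ← Finset.sum_sub_distrib]
        gcongr with s _ x _ y _ t _
        exact hv.integrand_le_loss hE hD s x y t

theorem optDP_le_optSC (κ : S → X → Y → T → ℝ) (P : S → ℝ) (W : X → Y → ℝ) :
    optDP κ P W ≤ optSC κ P W :=
  iSup₂_le fun _ hv => le_iInf₂ fun _ hE => le_iInf₂ fun _ hD =>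
    EReal.coe_le_coe_iff.2 (hv.objective_le_expectedLoss hE hD)

theorem optSC_le_expectedLoss (hE : IsChannel E) (hD : IsChannel D) :
    optSC κ P W ≤ ((expectedLoss κ P W E D : ℝ) : EReal) :=
  (iInf₂_le E hE).trans (iInf₂_le D hD)

theorem expectedLoss_single [DecidableEq X] [DecidableEq T] (κ : S → X → Y → T → ℝ) (P : S → ℝ)
    (W : X → Y → ℝ) (f : S → X) (g : Y → T) :
    expectedLoss κ P W (fun s => Pi.single (f s) 1) (fun y => Pi.single (g y) 1)
      = ∑ s, ∑ y, κ s (f s) y (g y) * (P s * W (f s) y) := by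
  refine Finset.sum_congr rfl fun s _ => ?_
  rw [Fintype.sum_eq_single (f s) fun x hx => by simp [Pi.single_eq_of_ne hx]]
  refine Finset.sum_congr rfl fun y _ => ?_
  rw [Fintype.sum_eq_single (g y) fun t ht => by simp [Pi.single_eq_of_ne ht]]
  simp only [Pi.single_eq_same, mul_one]

end WeakDuality

section OneShot

variable {X Y : Type*} [Fintype Y] {M : ℕ}

theorem optSC_le_detError [Fintype X] (W : X → Y → ℝ) (f : Fin M → X) (g : Y → Fin M) :
    optSC (errorLoss M X Y) (uniformSource M) W ≤ ((detError W f g : ℝ) : EReal) := by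
  classical
  have hloss : detError W f g = expectedLoss (errorLoss M X Y) (uniformSource M) W
      (fun s => Pi.single (f s) 1) fun y => Pi.single (g y) 1 := by
    rw [expectedLoss_single]
    simp only [detError, errorLoss, uniformSource, Finset.mul_sum, ite_mul, one_mul, zero_mul,
      mul_ite, mul_zero, ne_comm]
  rw [hloss]
  exact optSC_le_expectedLoss (fun s => single_mem_stdSimplex ℝ (f s))
    fun y => single_mem_stdSimplex ℝ (g y)

theorem detError_le_one {W : X → Y → ℝ} (hW : IsChannel W) (f : Fin M → X) (g : Y → Fin M) :
    detError W f g ≤ 1 := by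
  calc detError W f g
      ≤ ∑ s : Fin M, (1 / (M : ℝ)) * ∑ y, W (f s) y := by
        unfold detError
        gcongr with s _ y _
        split_ifs
        exacts [le_rfl, (hW (f s)).1 y]
    _ ≤ 1 := by simpa [(hW _).2] using mul_inv_le_one (a := (M : ℝ))

theorem optSC_le_one [Fintype X] [Nonempty X] {W : X → Y → ℝ} (hW : IsChannel W) (hM : 1 ≤ M) :
    optSC (errorLoss M X Y) (uniformSource M) W ≤ 1 :=
  (optSC_le_detError W (fun _ => Classical.arbitrary X) fun _ => ⟨0, hM⟩).trans
    (EReal.coe_le_coe_iff.2 (detError_le_one hW _ _))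

/-- The dual point behind the improved converse. The parameter `q` is an arbitrary measure on the
outputs, to be taken as `e^{-γ} P_Ȳ`, and `m` is a common lower bound for the masses of
`min (P_{Y|X=x}, M q)`. -/
def converseDual (W : X → Y → ℝ) (M : ℕ) (q : Y → ℝ) (m : ℝ) : DualVars (Fin M) X Y (Fin M) where
  gammaA _ := m / M
  gammaB y := -q y
  lambdaA s t y := if s = t then -q y else 0
  lambdaB x _ y := min (W x y) (M * q y) / M
  mu _ _ _ _ := 0

theorem converseDual_objective [Fintype X] (W : X → Y → ℝ) (hM : 1 ≤ M) (q : Y → ℝ) (m : ℝ) :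
    (converseDual W M q m).objective = m - ∑ y, q y := by
  have hM0 : (M : ℝ) ≠ 0 := by positivity
  simp only [DualVars.objective, converseDual, Finset.sum_const_zero, sub_zero,
    Finset.sum_neg_distrib, Finset.sum_const, Finset.card_univ, Fintype.card_fin, nsmul_eq_mul]
  field_simp
  ring

theorem converseDual_feasible [Fintype X] {W : X → Y → ℝ} (hM : 1 ≤ M) {q : Y → ℝ} {m : ℝ}
    (hm : ∀ x, m ≤ ∑ y, min (W x y) (M * q y)) :
    (converseDual W M q m).Feasible (errorLoss M X Y) (uniformSource M) W where
  d1 x s := by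
    simp only [converseDual, Finset.sum_const_zero, sub_zero, ← Finset.sum_div, sub_nonpos]
    gcongr
    exact hm x
  d2 t y := by simp [converseDual]
  d3 s x y t := by
    have hM0 : (0 : ℝ) < M := by exact_mod_cast hM
    obtain rfl | hst := eq_or_ne s t
    · have hmin : min (W x y) (M * q y) / M ≤ q y :=
        (div_le_iff₀' hM0).2 (min_le_right _ _)
      simpa [converseDual, errorLoss] using hmin
    · have hmin : min (W x y) (M * q y) / M ≤ W x y / M := by
        gcongr
        exact min_le_left _ _
      simpa [converseDual, errorLoss, uniformSource, hst, inv_mul_eq_div] using hmin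
  mu_nonneg _ _ _ _ := le_rfl

theorem infoDensity_le_coe_iff {X Y : Type*} {W : X → Y → ℝ} {Q : Y → ℝ} {x : X} {y : Y}
    (hQ : 0 ≤ Q y) (c : ℝ) :
    infoDensity W Q x y ≤ (c : EReal) ↔ W x y ≤ Real.exp c * Q y := by
  unfold infoDensity
  rw [← EReal.log_exp (c : EReal), ENNReal.log_le_log_iff, EReal.exp_coe,
    ENNReal.div_le_iff_le_mul (Or.inr ENNReal.ofReal_ne_top) (Or.inl ENNReal.ofReal_ne_top),
    ← ENNReal.ofReal_mul (Real.exp_pos c).le,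
    ENNReal.ofReal_le_ofReal_iff (mul_nonneg (Real.exp_pos c).le hQ)]

theorem probInfoLe_add_exp_mul_massInfoGt {Q : Y → ℝ} (hQ : ∀ y, 0 ≤ Q y) (W : X → Y → ℝ) (x : X)
    (c : ℝ) :
    probInfoLe W Q x c + Real.exp c * massInfoGt W Q x c
      = ∑ y, min (W x y) (Real.exp c * Q y) := by
  rw [probInfoLe, massInfoGt, Finset.mul_sum, ← Finset.sum_add_distrib]
  refine Finset.sum_congr rfl fun y _ => ?_
  simp only [← not_le, infoDensity_le_coe_iff (hQ y)]
  by_cases h : W x y ≤ Real.exp c * Q y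
  · simp [h]
  · simp [h, (not_le.1 h).le]

theorem improvedBound_le_optDP [Fintype X] (W : X → Y → ℝ) (hM : 1 ≤ M) :
    improvedBound W M ≤ optDP (errorLoss M X Y) (uniformSource M) W := by
  refine iSup_le fun γ => iSup₂_le fun Q hQ => ?_
  set bracket : X → ℝ := fun x => probInfoLe W Q x (Real.log M - γ)
    + M * Real.exp (-γ) * massInfoGt W Q x (Real.log M - γ) with hbracket
  have hexp : Real.exp (Real.log M - γ) = M * Real.exp (-γ) := by
    rw [sub_eq_add_neg, Real.exp_add, Real.exp_log (by exact_mod_cast hM)]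
  have hm : ∀ x, ⨅ x, bracket x ≤ ∑ y, min (W x y) (M * (Real.exp (-γ) * Q y)) := fun x => by
    refine (ciInf_le (Set.finite_range bracket).bddBelow x).trans_eq ?_
    simp only [hbracket, ← hexp, probInfoLe_add_exp_mul_massInfoGt hQ.1, ← mul_assoc]
  have hobj : (⨅ x, bracket x) - Real.exp (-γ)
      = (converseDual W M (fun y => Real.exp (-γ) * Q y) (⨅ x, bracket x)).objective := by
    rw [converseDual_objective W hM, ← Finset.mul_sum, hQ.2, mul_one]
  rw [hobj]
  exact le_iSup₂_of_le _ (converseDual_feasible hM hm) le_rfl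

theorem massInfoGt_nonneg {Q : Y → ℝ} (hQ : ∀ y, 0 ≤ Q y) (W : X → Y → ℝ) (x : X) (c : ℝ) :
    0 ≤ massInfoGt W Q x c :=
  Finset.sum_nonneg fun y _ => mul_nonneg (hQ y) (by split_ifs <;> norm_num)

theorem wolfowitzBound_le_improvedBound [Finite X] (W : X → Y → ℝ) (M : ℕ) :
    wolfowitzBound W M ≤ improvedBound W M := by
  refine iSup₂_le fun γ _ => iSup₂_le fun Q hQ =>
    le_iSup_of_le γ (le_iSup₂_of_le Q hQ (EReal.coe_le_coe_iff.2 ?_))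
  refine sub_le_sub_right (ciInf_mono (Set.finite_range _).bddBelow fun x => ?_) _
  exact le_add_of_nonneg_right (mul_nonneg (by positivity) (massInfoGt_nonneg hQ.1 W x _))

end OneShot

section RelativeEntropy

variable {B : Type*} {p q : B → ℝ}

theorem support_subset_support_mix (hp : ∀ b, 0 ≤ p b) (hq : ∀ b, 0 ≤ q b) {r : ℝ}
    (hr : r ∈ Set.Ioo (0 : ℝ) 1) : p.support ⊆ ((1 - r) • q + r • p).support := fun b hb => by
  have hpb : 0 < p b := (hp b).lt_of_ne' hb
  exact (add_pos_of_nonneg_of_pos (mul_nonneg (sub_nonneg.2 hr.2.le) (hq b))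
    (mul_pos hr.1 hpb)).ne'

variable [Fintype B]

/-- The Shannon entropy (in nats) of `p`. -/
def entropy (p : B → ℝ) : ℝ := ∑ b, Real.negMulLog (p b)

/-- The cross entropy (in nats) of `p` relative to `q`; meaningful when `q` vanishes only where
`p` does, since `Real.log 0 = 0`. -/
def crossEntropy (p q : B → ℝ) : ℝ := -∑ b, p b * Real.log (q b)

/-- The relative entropy `D(p ‖ q)` (in nats); meaningful when `q` vanishes only where `p` does,
since `Real.log (p b / 0) = 0`. -/
def relEntropy (p q : B → ℝ) : ℝ := ∑ b, p b * Real.log (p b / q b)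

theorem crossEntropy_self (p : B → ℝ) : crossEntropy p p = entropy p := by
  simp [crossEntropy, entropy, Real.negMulLog]

theorem relEntropy_eq_crossEntropy_sub_entropy (hpq : p.support ⊆ q.support) :
    relEntropy p q = crossEntropy p q - entropy p := by
  rw [← crossEntropy_self, crossEntropy, crossEntropy, neg_sub_neg, ← Finset.sum_sub_distrib]
  refine Finset.sum_congr rfl fun b _ => ?_
  by_cases hb : p b = 0
  · simp [hb]
  · rw [Real.log_div hb (hpq hb), mul_sub]

theorem relEntropy_nonneg (hp : p ∈ stdSimplex ℝ B) (hq : q ∈ stdSimplex ℝ B)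
    (hpq : p.support ⊆ q.support) : 0 ≤ relEntropy p q := by
  have hterm : ∀ b, q b * InformationTheory.klFun (p b / q b)
      = p b * Real.log (p b / q b) + (q b - p b) := fun b => by
    by_cases hb : q b = 0
    · simp [hb, Function.notMem_support.1 fun h => hpq h hb]
    · rw [InformationTheory.klFun_apply]
      field_simp
      ring
  calc 0 ≤ ∑ b, q b * InformationTheory.klFun (p b / q b) :=
        Finset.sum_nonneg fun b _ => mul_nonneg (hq.1 b)
          (InformationTheory.klFun_nonneg (div_nonneg (hp.1 b) (hq.1 b)))
    _ = relEntropy p q := by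
        simp only [hterm, Finset.sum_add_distrib, Finset.sum_sub_distrib, hp.2, hq.2, sub_self,
          add_zero, relEntropy]

theorem neg_mul_log_le_crossEntropy (hp : ∀ b, 0 ≤ p b) (hq : q ∈ stdSimplex ℝ B) (b : B) :
    -(p b * Real.log (q b)) ≤ crossEntropy p q := by
  rw [crossEntropy, ← Finset.sum_neg_distrib]
  refine Finset.single_le_sum (f := fun b => -(p b * Real.log (q b))) (fun b _ => ?_)
    (Finset.mem_univ b)
  exact neg_nonneg.2 (mul_nonpos_of_nonneg_of_nonpos (hp b)
    (Real.log_nonpos (hq.1 b) (mem_Icc_of_mem_stdSimplex hq b).2))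

theorem continuousAt_relEntropy_right (hpq : p.support ⊆ q.support) :
    ContinuousAt (relEntropy p) q := by
  refine tendsto_finsetSum _ fun b _ => ?_
  by_cases hb : p b = 0
  · simp [hb]
  · have hqb : q b ≠ 0 := hpq hb
    exact (((continuousAt_const.div (continuous_apply b).continuousAt hqb).log
      (div_ne_zero hb hqb)).const_mul (p b)).tendsto

variable {C : ℝ}

theorem support_subset_of_relEntropy_mix_le (hp : p ∈ stdSimplex ℝ B) (hq : q ∈ stdSimplex ℝ B)
    (hC : ∀ r ∈ Set.Ioo (0 : ℝ) 1, relEntropy p ((1 - r) • q + r • p) ≤ C) :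
    p.support ⊆ q.support := by
  intro b hb hqb
  have hpb : 0 < p b := (hp.1 b).lt_of_ne' hb
  have hbound : ∀ r ∈ Set.Ioo (0 : ℝ) 1, -p b * Real.log r ≤ C + entropy p := fun r hr => by
    have hmix : (1 - r) • q + r • p ∈ stdSimplex ℝ B :=
      convex_stdSimplex ℝ B hq hp (sub_nonneg.2 hr.2.le) hr.1.le (by ring)
    have hmixb : ((1 - r) • q + r • p) b = r * p b := by simp [hqb]
    have hlog : Real.log (r * p b) ≤ Real.log r :=
      Real.log_le_log (mul_pos hr.1 hpb)
        (mul_le_of_le_one_right hr.1.le (mem_Icc_of_mem_stdSimplex hp b).2)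
    have hcross := neg_mul_log_le_crossEntropy hp.1 hmix b
    have hle := hC r hr
    rw [relEntropy_eq_crossEntropy_sub_entropy (support_subset_support_mix hp.1 hq.1 hr)] at hle
    rw [hmixb] at hcross
    linarith [mul_le_mul_of_nonneg_left hlog hpb.le]
  have hdiverge : Tendsto (fun r => -p b * Real.log r) (𝓝[>] 0) atTop :=
    Real.tendsto_log_nhdsGT_zero.const_mul_atBot_of_neg (neg_lt_zero.2 hpb)
  obtain ⟨r, hlt, hr⟩ := ((hdiverge.eventually_gt_atTop (C + entropy p)).and
    (Ioo_mem_nhdsGT one_pos)).exists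
  exact (hbound r hr).not_gt hlt

theorem relEntropy_le_of_relEntropy_mix_le (hp : p ∈ stdSimplex ℝ B) (hq : q ∈ stdSimplex ℝ B)
    (hC : ∀ r ∈ Set.Ioo (0 : ℝ) 1, relEntropy p ((1 - r) • q + r • p) ≤ C) :
    relEntropy p q ≤ C := by
  have hmix : Tendsto (fun r : ℝ => (1 - r) • q + r • p) (𝓝[>] 0) (𝓝 q) := by
    have hcont : Continuous fun r : ℝ => (1 - r) • q + r • p := by fun_prop
    simpa using (hcont.tendsto 0).mono_left nhdsWithin_le_nhds
  have hlim := (continuousAt_relEntropy_right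
    (support_subset_of_relEntropy_mix_le hp hq hC)).tendsto.comp hmix
  exact le_of_tendsto hlim (mem_of_superset (Ioo_mem_nhdsGT one_pos) hC)

end RelativeEntropy

section Capacity

variable {A B : Type*} [Fintype A] {V : A → B → ℝ} {P : A → ℝ}

/-- The output law of the channel `V` as a linear function of the input law. -/
def outputLaw (V : A → B → ℝ) : (A → ℝ) →ₗ[ℝ] (B → ℝ) := Fintype.linearCombination ℝ V

theorem outputLaw_apply (V : A → B → ℝ) (P : A → ℝ) (b : B) :
    outputLaw V P b = ∑ a, P a * V a b := by
  simp [outputLaw, Fintype.linearCombination_apply]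

theorem outputLaw_single [DecidableEq A] (V : A → B → ℝ) (a : A) :
    outputLaw V (Pi.single a 1) = V a := by
  simp [outputLaw, Fintype.linearCombination_apply_single]

theorem support_subset_support_outputLaw (hP : ∀ a, 0 ≤ P a) (hV : ∀ a b, 0 ≤ V a b) {a : A}
    (ha : P a ≠ 0) : (V a).support ⊆ (outputLaw V P).support := fun b hb => by
  rw [Function.mem_support, outputLaw_apply]
  refine (Finset.sum_pos' (fun a _ => mul_nonneg (hP a) (hV a b)) ⟨a, Finset.mem_univ a, ?_⟩).ne'
  exact mul_pos ((hP a).lt_of_ne' ha) ((hV a b).lt_of_ne' hb)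

variable [Fintype B]

/-- The conditional relative entropy `D(V ‖ q | P)`, the average of `D(V a ‖ q)` for `a` drawn
from `P`, as a linear function of the input law `P`. -/
def condRelEntropy (V : A → B → ℝ) (q : B → ℝ) : (A → ℝ) →ₗ[ℝ] ℝ :=
  Fintype.linearCombination ℝ fun a => relEntropy (V a) q

theorem condRelEntropy_apply (V : A → B → ℝ) (q : B → ℝ) (P : A → ℝ) :
    condRelEntropy V q P = ∑ a, P a * relEntropy (V a) q := by
  simp only [condRelEntropy, Fintype.linearCombination_apply, smul_eq_mul]

theorem condRelEntropy_single [DecidableEq A] (V : A → B → ℝ) (q : B → ℝ) (a : A) :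
    condRelEntropy V q (Pi.single a 1) = relEntropy (V a) q := by
  simp [condRelEntropy, Fintype.linearCombination_apply_single]

theorem outputLaw_mem_stdSimplex (hP : P ∈ stdSimplex ℝ A) (hV : IsChannel V) :
    outputLaw V P ∈ stdSimplex ℝ B :=
  (convex_stdSimplex ℝ B).sum_mem (fun a _ => hP.1 a) hP.2 fun a _ => hV a

theorem crossEntropy_outputLaw (V : A → B → ℝ) (P : A → ℝ) (q : B → ℝ) :
    crossEntropy (outputLaw V P) q = ∑ a, P a * crossEntropy (V a) q := by
  simp only [crossEntropy, outputLaw_apply, Finset.sum_mul, mul_neg, Finset.sum_neg_distrib,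
    Finset.mul_sum, mul_assoc]
  rw [Finset.sum_comm]

theorem condRelEntropy_eq_crossEntropy_sub {q : B → ℝ}
    (hq : ∀ a, P a ≠ 0 → (V a).support ⊆ q.support) :
    condRelEntropy V q P = crossEntropy (outputLaw V P) q - ∑ a, P a * entropy (V a) := by
  rw [condRelEntropy_apply, crossEntropy_outputLaw, ← Finset.sum_sub_distrib]
  refine Finset.sum_congr rfl fun a _ => ?_
  by_cases ha : P a = 0
  · simp [ha]
  · rw [relEntropy_eq_crossEntropy_sub_entropy (hq a ha), mul_sub]

theorem mutualInfo_eq_condRelEntropy (V : A → B → ℝ) (P : A → ℝ) :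
    mutualInfo P V = condRelEntropy V (outputLaw V P) P := by
  simp only [mutualInfo, condRelEntropy_apply, relEntropy, outputLaw_apply, Finset.mul_sum,
    mul_assoc]

theorem mutualInfo_eq_entropy_sub (hP : P ∈ stdSimplex ℝ A) (hV : IsChannel V) :
    mutualInfo P V = entropy (outputLaw V P) - ∑ a, P a * entropy (V a) := by
  rw [mutualInfo_eq_condRelEntropy, condRelEntropy_eq_crossEntropy_sub fun a ha =>
    support_subset_support_outputLaw hP.1 (fun a => (hV a).1) ha, crossEntropy_self]

theorem condRelEntropy_eq_mutualInfo_add_relEntropy (hP : P ∈ stdSimplex ℝ A) (hV : IsChannel V)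
    {q : B → ℝ} (hq : (outputLaw V P).support ⊆ q.support) :
    condRelEntropy V q P = mutualInfo P V + relEntropy (outputLaw V P) q := by
  have hrow : ∀ a, P a ≠ 0 → (V a).support ⊆ q.support := fun a ha =>
    (support_subset_support_outputLaw hP.1 (fun a => (hV a).1) ha).trans hq
  rw [condRelEntropy_eq_crossEntropy_sub hrow, mutualInfo_eq_entropy_sub hP hV,
    relEntropy_eq_crossEntropy_sub_entropy hq]
  ring

theorem continuousOn_mutualInfo (hV : IsChannel V) :
    ContinuousOn (fun P => mutualInfo P V) (stdSimplex ℝ A) := by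
  have hcont : Continuous fun P : A → ℝ =>
      entropy (outputLaw V P) - ∑ a, P a * entropy (V a) := by
    simp only [entropy, outputLaw_apply]
    fun_prop
  exact hcont.continuousOn.congr fun P hP => mutualInfo_eq_entropy_sub hP hV

theorem exists_isMaxOn_mutualInfo [Nonempty A] (hV : IsChannel V) :
    ∃ P ∈ stdSimplex ℝ A, IsMaxOn (fun P => mutualInfo P V) (stdSimplex ℝ A) P := by
  classical
  exact (isCompact_stdSimplex ℝ A).exists_isMaxOn
    ⟨_, single_mem_stdSimplex ℝ (Classical.arbitrary A)⟩ (continuousOn_mutualInfo hV)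

theorem capacity_eq_mutualInfo (hP : P ∈ stdSimplex ℝ A)
    (hmax : IsMaxOn (fun P => mutualInfo P V) (stdSimplex ℝ A) P) :
    capacity V = mutualInfo P V :=
  IsGreatest.csSup_eq ⟨Set.mem_image_of_mem _ hP, Set.forall_mem_image.2 hmax⟩

/-- Both `I(P')` and `D(V ‖ Q' | P) = I(P) + D(Q ‖ Q') ≥ I(P)` are averages against the same output
law `Q'`, and the first is the mixture of the second with `D(V ‖ Q' | P₁)`. -/
theorem condRelEntropy_le_mutualInfo_of_mix_le {P₁ : A → ℝ} (hP : P ∈ stdSimplex ℝ A)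
    (hP₁ : P₁ ∈ stdSimplex ℝ A) (hV : IsChannel V) {r : ℝ} (hr : r ∈ Set.Ioo (0 : ℝ) 1)
    (hle : mutualInfo ((1 - r) • P + r • P₁) V ≤ mutualInfo P V) :
    condRelEntropy V (outputLaw V ((1 - r) • P + r • P₁)) P₁ ≤ mutualInfo P V := by
  have hr' : 1 - r ∈ Set.Ioo (0 : ℝ) 1 := ⟨sub_pos.2 hr.2, sub_lt_self 1 hr.1⟩
  set P' := (1 - r) • P + r • P₁ with hP'_def
  have hP' : P' ∈ stdSimplex ℝ A :=
    convex_stdSimplex ℝ A hP hP₁ hr'.1.le hr.1.le (by ring)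
  have hQ := outputLaw_mem_stdSimplex hP hV
  have hsupp : (outputLaw V P).support ⊆ (outputLaw V P').support := by
    have h := support_subset_support_mix hQ.1 (outputLaw_mem_stdSimplex hP₁ hV).1 hr'
    rwa [sub_sub_cancel, add_comm, ← map_smul, ← map_smul, ← map_add] at h
  have hbase : mutualInfo P V ≤ condRelEntropy V (outputLaw V P') P := by
    rw [condRelEntropy_eq_mutualInfo_add_relEntropy hP hV hsupp]
    exact le_add_of_nonneg_right
      (relEntropy_nonneg hQ (outputLaw_mem_stdSimplex hP' hV) hsupp)
  have hmix : mutualInfo P' V = (1 - r) * condRelEntropy V (outputLaw V P') P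
      + r * condRelEntropy V (outputLaw V P') P₁ := by
    rw [mutualInfo_eq_condRelEntropy]
    generalize outputLaw V P' = q
    rw [hP'_def, map_add, map_smul, map_smul, smul_eq_mul, smul_eq_mul]
  refine le_of_mul_le_mul_left ?_ hr.1
  linarith [mul_le_mul_of_nonneg_left hbase hr'.1.le]

theorem exists_relEntropy_le_capacity [Nonempty A] (hV : IsChannel V) :
    ∃ Q ∈ stdSimplex ℝ B, ∀ a, (V a).support ⊆ Q.support ∧ relEntropy (V a) Q ≤ capacity V := by
  classical
  obtain ⟨P, hP, hmax⟩ := exists_isMaxOn_mutualInfo hV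
  have hQ := outputLaw_mem_stdSimplex hP hV
  have hmix : ∀ a, ∀ r ∈ Set.Ioo (0 : ℝ) 1,
      relEntropy (V a) ((1 - r) • outputLaw V P + r • V a) ≤ capacity V := fun a r hr => by
    have ha := single_mem_stdSimplex ℝ a
    have h := condRelEntropy_le_mutualInfo_of_mix_le hP ha hV hr
      (hmax (convex_stdSimplex ℝ A hP ha (sub_nonneg.2 hr.2.le) hr.1.le (by ring)))
    rwa [condRelEntropy_single, map_add, map_smul, map_smul, outputLaw_single,
      ← capacity_eq_mutualInfo hP hmax] at h
  exact ⟨outputLaw V P, hQ, fun a => ⟨support_subset_of_relEntropy_mix_le (hV a) hQ (hmix a),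
    relEntropy_le_of_relEntropy_mix_le (hV a) hQ (hmix a)⟩⟩

theorem capacity_nonneg [Nonempty A] (hV : IsChannel V) : 0 ≤ capacity V := by
  obtain ⟨Q, hQ, hcap⟩ := exists_relEntropy_le_capacity hV
  obtain ⟨hsupp, hle⟩ := hcap (Classical.arbitrary A)
  exact (relEntropy_nonneg (hV _) hQ hsupp).trans hle

end Capacity

section ExponentialMoment

variable {B : Type*} [Fintype B]

/-- The moment `𝔼[(p / q) ^ θ]` under `p` of the likelihood ratio, i.e. `exp (θ D)` with `D` the
Rényi divergence of order `1 + θ`; it controls the upper tail of the information density. -/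
def likelihoodMoment (p q : B → ℝ) (θ : ℝ) : ℝ := ∑ b, p b * (p b / q b) ^ θ

variable {p q : B → ℝ}

theorem likelihoodMoment_nonneg (hp : ∀ b, 0 ≤ p b) (hq : ∀ b, 0 ≤ q b) (θ : ℝ) :
    0 ≤ likelihoodMoment p q θ :=
  Finset.sum_nonneg fun b _ =>
    mul_nonneg (hp b) (Real.rpow_nonneg (div_nonneg (hp b) (hq b)) θ)

theorem hasDerivAt_likelihoodMoment_zero (hp : ∀ b, 0 ≤ p b) (hq : ∀ b, 0 ≤ q b)
    (hpq : p.support ⊆ q.support) :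
    HasDerivAt (likelihoodMoment p q) (relEntropy p q) 0 := by
  refine HasDerivAt.fun_sum fun b _ => ?_
  by_cases hb : p b = 0
  · simpa [hb] using hasDerivAt_const (0 : ℝ) (0 : ℝ)
  · have hratio : 0 < p b / q b := div_pos ((hp b).lt_of_ne' hb) ((hq b).lt_of_ne' (hpq hb))
    simpa using (Real.hasStrictDerivAt_const_rpow hratio 0).hasDerivAt.const_mul (p b)

theorem eventually_likelihoodMoment_lt_exp (hp : p ∈ stdSimplex ℝ B) (hq : ∀ b, 0 ≤ q b)
    (hpq : p.support ⊆ q.support) {c : ℝ} (hc : relEntropy p q < c) :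
    ∀ᶠ θ in 𝓝[>] 0, likelihoodMoment p q θ < Real.exp (c * θ) := by
  have hexp : HasDerivAt (fun θ => Real.exp (c * θ)) c 0 := by
    simpa using ((hasDerivAt_id (0 : ℝ)).const_mul c).exp
  have hslope := ((hasDerivAt_likelihoodMoment_zero hp.1 hq hpq).sub
    hexp).tendsto_slope_zero_right.eventually_lt_const (sub_neg.2 hc)
  filter_upwards [hslope, self_mem_nhdsWithin] with θ hθ hθ0
  have hzero : likelihoodMoment p q 0 = 1 := by simp [likelihoodMoment, hp.2]
  simp only [zero_add, Pi.sub_apply, hzero, mul_zero, Real.exp_zero, sub_self, sub_zero,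
    smul_eq_mul] at hθ
  exact sub_neg.1 (neg_of_mul_neg_right hθ (inv_nonneg.2 (le_of_lt hθ0)))

theorem likelihoodMoment_pi {ι : Type*} [Fintype ι] [DecidableEq ι] {p q : ι → B → ℝ}
    (hp : ∀ i b, 0 ≤ p i b) (hq : ∀ i b, 0 ≤ q i b) (θ : ℝ) :
    likelihoodMoment (fun y : ι → B => ∏ i, p i (y i)) (fun y => ∏ i, q i (y i)) θ
      = ∏ i, likelihoodMoment (p i) (q i) θ := by
  simp only [likelihoodMoment, Fintype.prod_sum, Finset.prod_mul_distrib,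
    ← Finset.prod_div_distrib]
  refine Finset.sum_congr rfl fun y _ => ?_
  rw [Real.finsetProd_rpow _ _ fun i _ => div_nonneg (hp i _) (hq i _)]

theorem one_sub_likelihoodMoment_le_probInfoLe {X : Type*} {W : X → B → ℝ} {x : X}
    (hW : W x ∈ stdSimplex ℝ B) (hq : ∀ b, 0 ≤ q b) (hWq : (W x).support ⊆ q.support) {θ : ℝ}
    (hθ : 0 ≤ θ) (s : ℝ) :
    1 - likelihoodMoment (W x) q θ / Real.exp (s * θ) ≤ probInfoLe W q x s := by
  rw [← hW.2, likelihoodMoment, Finset.sum_div, ← Finset.sum_sub_distrib]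
  refine Finset.sum_le_sum fun b _ => ?_
  have hratio : 0 ≤ W x b / q b := div_nonneg (hW.1 b) (hq b)
  simp only [infoDensity_le_coe_iff (hq b)]
  split_ifs with hle
  · rw [mul_one]
    exact sub_le_self _ (div_nonneg (mul_nonneg (hW.1 b) (Real.rpow_nonneg hratio θ))
      (Real.exp_pos _).le)
  · have hlt : Real.exp s * q b < W x b := not_le.1 hle
    have hWb : 0 < W x b := (mul_nonneg (Real.exp_pos s).le (hq b)).trans_lt hlt
    have hqb : 0 < q b := (hq b).lt_of_ne' (hWq hWb.ne')
    have hmarkov : Real.exp (s * θ) ≤ (W x b / q b) ^ θ := by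
      rw [Real.exp_mul]
      exact Real.rpow_le_rpow (Real.exp_pos s).le ((le_div_iff₀ hqb).2 hlt.le) hθ
    rw [mul_zero, sub_nonpos, le_div_iff₀ (Real.exp_pos _)]
    exact mul_le_mul_of_nonneg_left hmarkov hWb.le

end ExponentialMoment

section StrongConverse

variable {A B : Type*} [Fintype B] {V : A → B → ℝ}

theorem prod_mem_stdSimplex {ι : Type*} [Fintype ι] [DecidableEq ι] {p : ι → B → ℝ}
    (hp : ∀ i, p i ∈ stdSimplex ℝ B) :
    (fun y : ι → B => ∏ i, p i (y i)) ∈ stdSimplex ℝ (ι → B) := by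
  refine ⟨fun y => Finset.prod_nonneg fun i _ => (hp i).1 _, ?_⟩
  simp only [← Fintype.prod_sum, (hp _).2, Finset.prod_const_one]

theorem IsChannel.memoryless (hV : IsChannel V) (n : ℕ) : IsChannel (memoryless V n) :=
  fun x => prod_mem_stdSimplex fun i => hV (x i)

theorem one_sub_pow_le_probInfoLe_memoryless (hV : IsChannel V) {Q : B → ℝ}
    (hQ : Q ∈ stdSimplex ℝ B) (hVQ : ∀ a, (V a).support ⊆ Q.support) {θ c ρ s : ℝ} (hθ : 0 ≤ θ)
    (hρ : 0 ≤ ρ) (hmoment : ∀ a, likelihoodMoment (V a) Q θ ≤ ρ * Real.exp (c * θ)) {n : ℕ}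
    (hs : n * c ≤ s) (x : Fin n → A) :
    1 - ρ ^ n ≤ probInfoLe (memoryless V n) (fun y => ∏ i, Q (y i)) x s := by
  have hsupp : (memoryless V n x).support ⊆ Function.support fun y => ∏ i, Q (y i) :=
    fun y hy => Finset.prod_ne_zero_iff.2 fun i hi =>
      hVQ (x i) (Finset.prod_ne_zero_iff.1 hy i hi)
  refine le_trans (sub_le_sub_left ?_ 1) (one_sub_likelihoodMoment_le_probInfoLe
    (hV.memoryless n x) (prod_mem_stdSimplex fun _ => hQ).1 hsupp hθ s)
  rw [div_le_iff₀ (Real.exp_pos _)]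
  calc likelihoodMoment (memoryless V n x) (fun y => ∏ i, Q (y i)) θ
      = ∏ i, likelihoodMoment (V (x i)) Q θ :=
        likelihoodMoment_pi (fun i => (hV (x i)).1) (fun _ => hQ.1) θ
    _ ≤ ∏ _i : Fin n, ρ * Real.exp (c * θ) :=
        Finset.prod_le_prod (fun i _ => likelihoodMoment_nonneg (hV (x i)).1 hQ.1 θ)
          fun i _ => hmoment (x i)
    _ = ρ ^ n * Real.exp (n * c * θ) := by
        simp [mul_pow, ← Real.exp_nat_mul, mul_assoc]
    _ ≤ ρ ^ n * Real.exp (s * θ) := by gcongr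

theorem exists_one_sub_pow_le_probInfoLe_memoryless [Fintype A] [Nonempty A] (hV : IsChannel V)
    {c : ℝ} (hc : capacity V < c) :
    ∃ Q ∈ stdSimplex ℝ B, ∃ ρ ∈ Set.Ico (0 : ℝ) 1, ∀ (n : ℕ) (s : ℝ), n * c ≤ s →
      ∀ x, 1 - ρ ^ n ≤ probInfoLe (memoryless V n) (fun y => ∏ i, Q (y i)) x s := by
  obtain ⟨Q, hQ, hcap⟩ := exists_relEntropy_le_capacity hV
  have hevent : ∀ᶠ θ in 𝓝[>] (0 : ℝ), ∀ a, likelihoodMoment (V a) Q θ < Real.exp (c * θ) :=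
    eventually_all.2 fun a => eventually_likelihoodMoment_lt_exp (hV a) hQ.1 (hcap a).1
      ((hcap a).2.trans_lt hc)
  obtain ⟨θ, hlt, hθ⟩ := (hevent.and self_mem_nhdsWithin).exists
  obtain ⟨a₀, ha₀⟩ := Finite.exists_max fun a => likelihoodMoment (V a) Q θ
  have hρ0 : 0 ≤ likelihoodMoment (V a₀) Q θ / Real.exp (c * θ) :=
    div_nonneg (likelihoodMoment_nonneg (hV a₀).1 hQ.1 θ) (Real.exp_pos _).le
  refine ⟨Q, hQ, _, ⟨hρ0, (div_lt_one (Real.exp_pos _)).2 (hlt a₀)⟩, fun n s hs =>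
    one_sub_pow_le_probInfoLe_memoryless hV hQ (fun a => (hcap a).1) (le_of_lt hθ) hρ0
      (fun a => ?_) hs⟩
  rw [div_mul_cancel₀ _ (Real.exp_pos _).ne']
  exact ha₀ a

theorem sub_log_two_le_log_of_floor_exp_le {r : ℝ} (hr : 0 ≤ r) {M : ℕ}
    (hM : ⌊Real.exp r⌋₊ ≤ M) : r - Real.log 2 ≤ Real.log M := by
  have hfloor : (1 : ℝ) ≤ ⌊Real.exp r⌋₊ := by exact_mod_cast Nat.floor_pos.2 (Real.one_le_exp hr)
  have hlt : Real.exp r < ⌊Real.exp r⌋₊ + 1 := Nat.lt_floor_add_one _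
  have hcast : (⌊Real.exp r⌋₊ : ℝ) ≤ M := by exact_mod_cast hM
  calc r - Real.log 2 = Real.log (Real.exp r / 2) := by
        rw [Real.log_div (Real.exp_pos r).ne' two_ne_zero, Real.log_exp]
    _ ≤ Real.log M := Real.log_le_log (by positivity) (by linarith)

variable [Fintype A] [Nonempty A] {R : ℝ} {M : ℕ → ℕ}

theorem eventually_one_le_of_capacity_lt (hV : IsChannel V) (hR : capacity V < R)
    (hM : ∀ᶠ n : ℕ in atTop, ⌊Real.exp (n * R)⌋₊ ≤ M n) : ∀ᶠ n in atTop, 1 ≤ M n := by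
  have hR0 : 0 ≤ R := (capacity_nonneg hV).trans hR.le
  filter_upwards [hM] with n hn
  exact (Nat.floor_pos.2 (Real.one_le_exp (by positivity))).trans_le hn

theorem exists_exp_decay_le_wolfowitzBound (hV : IsChannel V) (hR : capacity V < R)
    (hM : ∀ᶠ n : ℕ in atTop, ⌊Real.exp (n * R)⌋₊ ≤ M n) :
    ∃ ρ ∈ Set.Ico (0 : ℝ) 1, ∃ δ > 0, ∀ᶠ n : ℕ in atTop,
      ((1 - ρ ^ n - Real.exp (-(n * δ)) : ℝ) : EReal)
        ≤ wolfowitzBound (memoryless V n) (M n) := by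
  -- of the gap `3 δ = R - C`, one `δ` pays for the tail of the information density,
  -- one is the slope of `γ = n δ`, and the last one absorbs the rounding of `e ^ (n R)`
  obtain ⟨δ, hδ⟩ : ∃ δ, R = capacity V + δ + 2 * δ := ⟨(R - capacity V) / 3, by ring⟩
  have hδ0 : 0 < δ := by linarith
  have hR0 : 0 ≤ R := (capacity_nonneg hV).trans hR.le
  obtain ⟨Q, hQ, ρ, hρ, htail⟩ :=
    exists_one_sub_pow_le_probInfoLe_memoryless hV (lt_add_of_pos_right (capacity V) hδ0)
  have hnδ : Tendsto (fun n : ℕ => (n : ℝ) * δ) atTop atTop :=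
    tendsto_natCast_atTop_atTop.atTop_mul_const hδ0
  refine ⟨ρ, hρ, δ, hδ0, ?_⟩
  filter_upwards [hM, hnδ.eventually_ge_atTop (Real.log 2), hnδ.eventually_gt_atTop 0]
    with n hMn hlog2 hγ
  refine le_iSup₂_of_le (n * δ) hγ (le_iSup₂_of_le _ (prod_mem_stdSimplex fun _ => hQ)
    (EReal.coe_le_coe_iff.2 (sub_le_sub_right (le_ciInf fun x => htail n _ ?_ x) _)))
  have hlogM := sub_log_two_le_log_of_floor_exp_le (by positivity) hMn
  rw [hδ] at hlogM
  linarith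

theorem wolfowitzBound_le_one {X Y : Type*} [Finite X] [Nonempty X] [Fintype Y] {W : X → Y → ℝ}
    (hW : IsChannel W) {M : ℕ} (hM : 1 ≤ M) : wolfowitzBound W M ≤ 1 := by
  cases nonempty_fintype X
  exact (wolfowitzBound_le_improvedBound W M).trans <| (improvedBound_le_optDP W hM).trans <|
    (optDP_le_optSC _ _ _).trans (optSC_le_one hW hM)

theorem tendsto_wolfowitzBound_memoryless (hV : IsChannel V) (hR : capacity V < R)
    (hM : ∀ᶠ n : ℕ in atTop, ⌊Real.exp (n * R)⌋₊ ≤ M n) :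
    Tendsto (fun n => wolfowitzBound (memoryless V n) (M n)) atTop (𝓝 1) := by
  obtain ⟨ρ, hρ, δ, hδ, hle⟩ := exists_exp_decay_le_wolfowitzBound hV hR hM
  have hpow := tendsto_pow_atTop_nhds_zero_of_lt_one hρ.1 hρ.2
  have hexp := Real.tendsto_exp_neg_atTop_nhds_zero.comp
    (tendsto_natCast_atTop_atTop.atTop_mul_const hδ)
  have hlower : Tendsto (fun n : ℕ => 1 - ρ ^ n - Real.exp (-(n * δ))) atTop (𝓝 1) := by
    simpa using (hpow.const_sub 1).sub hexp
  refine tendsto_of_tendsto_of_tendsto_of_le_of_le' (EReal.tendsto_coe.2 hlower)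
    tendsto_const_nhds hle ?_
  exact (eventually_one_le_of_capacity_lt hV hR hM).mono fun n hn =>
    wolfowitzBound_le_one (hV.memoryless n) hn

end StrongConverse

end

end JSCC

theorem mainTheorem4 :
    -- the converse for an arbitrary finite channel and `M` equiprobable messages
    (∀ (X Y : Type*) [Fintype X] [Nonempty X] [Fintype Y] (W : X → Y → ℝ) (M : ℕ),
      JSCC.IsChannel W → 1 ≤ M →
        (∀ (E : Fin M → X → ℝ) (D : Y → Fin M → ℝ), JSCC.IsChannel E → JSCC.IsChannel D →
          JSCC.optSC (JSCC.errorLoss M X Y) (JSCC.uniformSource M) W ≤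
            ((JSCC.expectedLoss (JSCC.errorLoss M X Y) (JSCC.uniformSource M) W E D : ℝ)
              : EReal)) ∧
        (∀ (f : Fin M → X) (g : Y → Fin M),
          JSCC.optSC (JSCC.errorLoss M X Y) (JSCC.uniformSource M) W ≤
            ((JSCC.detError W f g : ℝ) : EReal)) ∧
        JSCC.optDP (JSCC.errorLoss M X Y) (JSCC.uniformSource M) W ≤
          JSCC.optSC (JSCC.errorLoss M X Y) (JSCC.uniformSource M) W ∧
        JSCC.improvedBound W M ≤
          JSCC.optDP (JSCC.errorLoss M X Y) (JSCC.uniformSource M) W ∧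
        JSCC.wolfowitzBound W M ≤ JSCC.improvedBound W M) ∧
    -- the strong converse for stationary memoryless channels
    (∀ (A B : Type*) [Fintype A] [Nonempty A] [Fintype B] (V : A → B → ℝ) (R : ℝ) (M : ℕ → ℕ),
      JSCC.IsChannel V → JSCC.capacity V < R →
      (∀ᶠ n : ℕ in atTop, ⌊Real.exp (n * R)⌋₊ ≤ M n) →
        Tendsto (fun n => JSCC.improvedBound (JSCC.memoryless V n) (M n)) atTop (𝓝 1) ∧
        Tendsto (fun n => JSCC.optDP (JSCC.errorLoss (M n) (Fin n → A) (Fin n → B))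
          (JSCC.uniformSource (M n)) (JSCC.memoryless V n)) atTop (𝓝 1) ∧
        Tendsto (fun n => JSCC.optSC (JSCC.errorLoss (M n) (Fin n → A) (Fin n → B))
          (JSCC.uniformSource (M n)) (JSCC.memoryless V n)) atTop (𝓝 1)) := by
  refine ⟨fun X Y _ _ _ W M _ hM => ⟨fun E D hE hD => JSCC.optSC_le_expectedLoss hE hD,
    JSCC.optSC_le_detError W, JSCC.optDP_le_optSC _ _ _, JSCC.improvedBound_le_optDP W hM,
    JSCC.wolfowitzBound_le_improvedBound W M⟩, fun A B _ _ _ V R M hV hR hM => ?_⟩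
  have hWB := fun n => JSCC.wolfowitzBound_le_improvedBound (JSCC.memoryless V n) (M n)
  have hDS := fun n => JSCC.optDP_le_optSC (JSCC.errorLoss (M n) (Fin n → A) (Fin n → B))
    (JSCC.uniformSource (M n)) (JSCC.memoryless V n)
  have hM1 := JSCC.eventually_one_le_of_capacity_lt hV hR hM
  have hBD := hM1.mono fun n hn => JSCC.improvedBound_le_optDP (JSCC.memoryless V n) hn
  have hS1 := hM1.mono fun n hn => JSCC.optSC_le_one (hV.memoryless n) hn
  have squeeze : ∀ {f : ℕ → EReal}, (∀ᶠ n in atTop,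
      JSCC.wolfowitzBound (JSCC.memoryless V n) (M n) ≤ f n) → (∀ᶠ n in atTop, f n ≤ 1) →
      Tendsto f atTop (𝓝 1) := fun hlower hupper =>
    tendsto_of_tendsto_of_tendsto_of_le_of_le' (JSCC.tendsto_wolfowitzBound_memoryless hV hR hM)
      tendsto_const_nhds hlower hupper
  refine ⟨squeeze (.of_forall hWB) ?_, squeeze ?_ ?_, squeeze ?_ hS1⟩
  · filter_upwards [hBD, hS1] with n hn hn1 using (hn.trans (hDS n)).trans hn1
  · filter_upwards [hBD] with n hn using (hWB n).trans hn
  · filter_upwards [hS1] with n hn1 using (hDS n).trans hn1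
  · filter_upwards [hBD] with n hn using ((hWB n).trans hn).trans (hDS n)
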